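/- Let $\rho$ and $\sigma$ be density operators (positive semidefinite, unit trace) on a finite-dimensional complex Hilbert space of dimension $d$, with spectral decompositions $\rho=\sum_{i=1}^d\lambda_i|x_i\rangle\langle x_i|$ and $\sigma=\sum_{j=1}^d\mu_j|y_j\rangle\langle y_j|$ in orthonormal bases $(x_i)$, $(y_j)$, and let $P_{ij}=\lambda_i|\langle x_i|y_j\rangle|^2$, $Q_{ij}=\mu_j|\langle x_i|y_j\rangle|^2$ be their Nussbaum–Szkoła distributions. Let $D(P\|Q)=\sum_{i,j}P_{ij}\log\frac{P_{ij}}{Q_{ij}}$ be the relative entropy ($+\infty$ if $P$ is not absolutely continuous with respect to $Q$) and $V(P\|Q)=\mathbb E_P\big[(\log\frac PQ-D(P\|Q))^2\big]$. For density operators $\tau,\omega$ on a common finite-dimensional space and $\varepsilon\ge 0$, let $$\beta_\varepsilon(\tau,\omega)=\inf\{\operatorname{Tr}[(I-\Pi)\omega] : 0\preceq\Pi\preceq I,\ \operatorname{Tr}[\Pi\tau]\le\varepsilon\},\qquad D_h^{\varepsilon}(\tau\|\omega)=-\log\beta_\varepsilon(\tau,\omega),$$ with $-\log 0=+\infty$;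 $\log$ is the natural logarithm. Let $(a_n)$ be a nonnegative sequence with $a_n\to0$ and $na_n^2\to\infty$ as $n\to\infty$, and let $\varepsilon_n=e^{-na_n^2}$. Then $$D_h^{\varepsilon_n}(\rho^{\otimes n}\|\sigma^{\otimes n})\le nD(P\|Q)-\sqrt{2V(P\|Q)}\,na_n+o(na_n)\qquad(n\to\infty),$$ where the right-hand side is read as $+\infty$ if $D(P\|Q)=+\infty$. -/

import Mathlib

open Filter Topology Asymptotics
open scoped ComplexOrder

noncomputable section

namespace QHT

variable {ι : Type*} [Fintype ι] [DecidableEq ι]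

/-- Density operators on `ℂ^ι`: positive semidefinite (hence self-adjoint) with unit trace. -/
def IsDensity (ρ : Matrix ι ι ℂ) : Prop :=
  ρ.PosSemidef ∧ ρ.trace = 1

/-- Binary tests: operators `T` with `0 ≼ T ≼ I` (`T` is associated with the decision `H₁`). -/
def IsTest (T : Matrix ι ι ℂ) : Prop :=
  T.PosSemidef ∧ (1 - T).PosSemidef

/-- Type-I error `Tr[T ρ]` (a real number for a test and a density operator). -/
def typeI (ρ T : Matrix ι ι ℂ) : ℝ := (T * ρ).trace.re

/-- Type-II error `Tr[(I - T) σ]`. -/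
def typeII (σ T : Matrix ι ι ℂ) : ℝ := ((1 - T) * σ).trace.re

/-- The optimal trade-off `β_α(ρ, σ)`: the infimum of the type-II error over all tests whose
type-I error is at most `α`. -/
def beta (α : ℝ) (ρ σ : Matrix ι ι ℂ) : ENNReal :=
  ⨅ (T : Matrix ι ι ℂ) (_ : IsTest T) (_ : typeI ρ T ≤ α), ENNReal.ofReal (typeII σ T)

/-- Hypothesis testing relative entropy `-log β_ε(ρ, σ)` (natural logarithm), equal to `+∞`
when `β_ε(ρ, σ) = 0`. -/
def hypRelEntropy (ε : ℝ) (ρ σ : Matrix ι ι ℂ) : EReal :=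
  - ENNReal.log (beta ε ρ σ)

/-- The `n`-fold tensor (Kronecker) power `ρ^{⊗n}`, acting on `(ℂ^ι)^{⊗n} = ℂ^(Fin n → ι)`. -/
def tensorPow (ρ : Matrix ι ι ℂ) (n : ℕ) : Matrix (Fin n → ι) (Fin n → ι) ℂ :=
  Matrix.of fun i j => ∏ k, ρ (i k) (j k)

/-- `ρ = ∑ i, lam i |x i⟩⟨x i|` is a spectral decomposition in the orthonormal basis `x`. -/
def IsSpectralDecomp (ρ : Matrix ι ι ℂ) (lam : ι → ℝ)
    (x : OrthonormalBasis ι ℂ (EuclideanSpace ℂ ι)) : Prop :=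
  ρ = ∑ i, (lam i : ℂ) • Matrix.vecMulVec (x i).ofLp (star (x i).ofLp)

/-- First Nussbaum–Szkoła distribution `P_{ij} = lam_i |⟨x_i | y_j⟩|²`. -/
def nsP (lam : ι → ℝ) (x y : OrthonormalBasis ι ℂ (EuclideanSpace ℂ ι)) : ι × ι → ℝ :=
  fun k => lam k.1 * ‖inner ℂ (x k.1) (y k.2)‖ ^ 2

/-- Second Nussbaum–Szkoła distribution `Q_{ij} = mu_j |⟨x_i | y_j⟩|²`. -/
def nsQ (mu : ι → ℝ) (x y : OrthonormalBasis ι ℂ (EuclideanSpace ℂ ι)) : ι × ι → ℝ :=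
  fun k => mu k.2 * ‖inner ℂ (x k.1) (y k.2)‖ ^ 2

/-- Log-likelihood ratio `log (P / Q)` (used only where `P` and `Q` are positive). -/
def llr {κ : Type*} (P Q : κ → ℝ) (k : κ) : ℝ := Real.log (P k / Q k)

open Classical in
/-- Relative entropy `D(P‖Q) = ∑ P log (P / Q)` of distributions on a finite set, equal to `+∞`
when `P` is not absolutely continuous with respect to `Q`. -/
def relEntropy {κ : Type*} [Fintype κ] (P Q : κ → ℝ) : EReal :=
  if ∀ k, Q k = 0 → P k = 0 then ((∑ k, P k * llr P Q k : ℝ) : EReal) else ⊤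

/-- Relative entropy variance `V(P‖Q) = E_P[(log (P / Q) - D(P‖Q))²]`, meaningful when
`D(P‖Q)` is finite. -/
def relVariance {κ : Type*} [Fintype κ] (P Q : κ → ℝ) : ℝ :=
  ∑ k, P k * (llr P Q k - (relEntropy P Q).toReal) ^ 2

end QHT

end

/-! Any test `T` satisfies `½ ∑ min(Pⁿ, θ Qⁿ) ≤ typeI + θ · typeII` (`sum_min_prod_le`), which
reduces the converse to a lower bound on a classical overlap. That bound
(`eventually_le_sum_min_prod`) is a change of measure. With `Z = D - log(P/Q)`, the tilt `R = P(1 +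
sZ)`, `s = c aₙ`, has relative entropy about `s²V/2` to `P` and moves the mean of `log(P/Q)` to `D -
sV`. If `c²V/2 < 1`, the cost stays below `aₙ²` per copy, so at `θ = exp(n(D - cV aₙ + δ aₙ))` the
overlap is at least `4εₙ`. Hence `typeII ≥ εₙ/θ`. Letting `c` approach `√(2/V)` turns `cV` into
`√(2V)`, and `-log εₙ = n aₙ²` is `o(n aₙ)`. -/

namespace QHT

/-! ### Classical moderate deviations for product distributions. -/

section Classical

variable {κ : Type*} [Fintype κ]

lemma sum_prod_fin (R : κ → ℝ) (hR : ∑ k, R k = 1) (n : ℕ) :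
    ∑ k : Fin n → κ, ∏ l, R (k l) = 1 := by
  classical
  rw [← Fintype.piFinset_univ, ← Finset.prod_univ_sum]
  simp [hR]

/-- Second moment of a shifted sum of independent centred variables. -/
lemma sum_prod_mul_add_sq (R g : κ → ℝ) (hR : ∑ k, R k = 1) (hg : ∑ k, R k * g k = 0)
    (n : ℕ) (c : ℝ) :
    ∑ k : Fin n → κ, (∏ l, R (k l)) * (c + ∑ l, g (k l)) ^ 2 =
      c ^ 2 + n * ∑ k, R k * g k ^ 2 := by
  -- The shift `c` absorbs the first coordinate: the hypothesis is used at `c + g k`.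
  induction n generalizing c with
  | zero => simp
  | succ n ih =>
    rw [← (Fin.consEquiv fun _ : Fin (n + 1) => κ).sum_comp, Fintype.sum_prod_type]
    have h : ∀ k : κ, ∑ t : Fin n → κ,
        (∏ l, R ((Fin.consEquiv fun _ : Fin (n + 1) => κ) (k, t) l)) *
          (c + ∑ l, g ((Fin.consEquiv fun _ : Fin (n + 1) => κ) (k, t) l)) ^ 2 =
        R k * ((c + g k) ^ 2 + n * ∑ k, R k * g k ^ 2) := by
      intro k
      rw [← ih, Finset.mul_sum]
      refine Finset.sum_congr rfl fun t _ => ?_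
      simp [Fin.consEquiv, Fin.prod_univ_succ, Fin.sum_univ_succ, mul_assoc, add_assoc]
    rw [Finset.sum_congr rfl fun k _ => h k]
    have h2 : ∀ k, R k * ((c + g k) ^ 2 + n * ∑ k, R k * g k ^ 2) =
        R k * (c ^ 2 + n * ∑ k, R k * g k ^ 2) + 2 * c * (R k * g k) + R k * g k ^ 2 := by
      intro k; ring
    rw [Finset.sum_congr rfl fun k _ => h2 k, Finset.sum_add_distrib, Finset.sum_add_distrib,
      ← Finset.sum_mul, ← Finset.mul_sum, hR, hg]
    push_cast
    ring

lemma sum_prod_mul_sq (R g : κ → ℝ) (hR : ∑ k, R k = 1) (m : ℝ) (hg : ∑ k, R k * g k = m)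
    (n : ℕ) :
    ∑ k : Fin n → κ, (∏ l, R (k l)) * (∑ l, g (k l) - n * m) ^ 2 =
      n * ((∑ k, R k * g k ^ 2) - m ^ 2) := by
  have h0 : ∑ k, R k * (g k - m) = 0 := by
    simp_rw [mul_sub, Finset.sum_sub_distrib, ← Finset.sum_mul, hR, hg]; ring
  have h := sum_prod_mul_add_sq R (fun k => g k - m) hR h0 n 0
  have h1 : ∑ k, R k * (g k - m) ^ 2 = (∑ k, R k * g k ^ 2) - m ^ 2 := by
    have : ∀ k, R k * (g k - m) ^ 2 = R k * g k ^ 2 - 2 * m * (R k * g k) + R k * m ^ 2 := by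
      intro k; ring
    rw [Finset.sum_congr rfl fun k _ => this k, Finset.sum_add_distrib, Finset.sum_sub_distrib,
      ← Finset.sum_mul, ← Finset.mul_sum, hR, hg]
    ring
  rw [h1] at h
  simpa using h

/-- Change of measure with two Chebyshev bounds: a lower bound on the overlap
`∑ min (Pⁿ, e^{nτ} Qⁿ)` through an auxiliary distribution `R`. -/
lemma le_sum_min_prod (P Q R g ℓ : κ → ℝ) (hP : ∀ k, 0 ≤ P k) (hQ : ∀ k, 0 ≤ Q k)
    (hR0 : ∀ k, 0 ≤ R k) (hR : ∑ k, R k = 1)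
    (hg : ∀ k, R k ≠ 0 → P k = R k * Real.exp (-g k))
    (hℓ : ∀ k, R k ≠ 0 → P k = Q k * Real.exp (ℓ k))
    {m₁ m₂ α τ η₁ η₂ K₁ K₂ : ℝ}
    (hm₁ : ∑ k, R k * g k = m₁) (hm₂ : ∑ k, R k * ℓ k = m₂)
    (hK₁ : (∑ k, R k * g k ^ 2) - m₁ ^ 2 ≤ K₁) (hK₂ : (∑ k, R k * ℓ k ^ 2) - m₂ ^ 2 ≤ K₂)
    (hη₁ : 0 < η₁) (hη₂ : 0 < η₂) (hα : m₁ + η₁ ≤ α) (hτ : m₂ + η₂ ≤ τ) (n : ℕ) (hn : 0 < n) :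
    Real.exp (-(n * α)) * (1 - K₁ / (n * η₁ ^ 2) - K₂ / (n * η₂ ^ 2)) ≤
      ∑ k : Fin n → κ, min (∏ l, P (k l)) (Real.exp (n * τ) * ∏ l, Q (k l)) := by
  have hn' : (0 : ℝ) < n := by exact_mod_cast hn
  -- Chebyshev done pointwise: the bracket is nonpositive when either sum exceeds its mean by `n η`,
  -- and at most `Rⁿ` otherwise.
  have key : ∀ k : Fin n → κ, Real.exp (-(n * α)) * ((∏ l, R (k l))
      - (∏ l, R (k l)) * (∑ l, g (k l) - n * m₁) ^ 2 / (n * η₁) ^ 2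
      - (∏ l, R (k l)) * (∑ l, ℓ (k l) - n * m₂) ^ 2 / (n * η₂) ^ 2) ≤
      min (∏ l, P (k l)) (Real.exp (n * τ) * ∏ l, Q (k l)) := by
    intro k
    have hRk : 0 ≤ ∏ l, R (k l) := Finset.prod_nonneg fun l _ => hR0 _
    have hPk : 0 ≤ ∏ l, P (k l) := Finset.prod_nonneg fun l _ => hP _
    have hQk : 0 ≤ ∏ l, Q (k l) := Finset.prod_nonneg fun l _ => hQ _
    have hmin : 0 ≤ min (∏ l, P (k l)) (Real.exp (n * τ) * ∏ l, Q (k l)) :=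
      le_min hPk (by positivity)
    have he := Real.exp_pos (-(n * α))
    set S₁ := ∑ l, g (k l) - n * m₁ with hS₁
    set S₂ := ∑ l, ℓ (k l) - n * m₂ with hS₂
    have e : (∏ l, R (k l)) - (∏ l, R (k l)) * S₁ ^ 2 / (n * η₁) ^ 2
        - (∏ l, R (k l)) * S₂ ^ 2 / (n * η₂) ^ 2 =
        (∏ l, R (k l)) * (1 - S₁ ^ 2 / (n * η₁) ^ 2 - S₂ ^ 2 / (n * η₂) ^ 2) := by ring
    rw [e]
    have p1 : 0 ≤ S₁ ^ 2 / (n * η₁) ^ 2 := by positivity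
    have p2 : 0 ≤ S₂ ^ 2 / (n * η₂) ^ 2 := by positivity
    have bad : ∀ {x y : ℝ}, 0 < y → y ≤ x → 1 ≤ x ^ 2 / y ^ 2 := fun {x y} hy hxy => by
      rw [le_div_iff₀ (by positivity), one_mul]
      exact pow_le_pow_left₀ hy.le hxy 2
    have neg : (1 - S₁ ^ 2 / (n * η₁) ^ 2 - S₂ ^ 2 / (n * η₂) ^ 2) ≤ 0 →
        Real.exp (-(n * α)) *
          ((∏ l, R (k l)) * (1 - S₁ ^ 2 / (n * η₁) ^ 2 - S₂ ^ 2 / (n * η₂) ^ 2)) ≤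
        min (∏ l, P (k l)) (Real.exp (n * τ) * ∏ l, Q (k l)) := fun h =>
      (mul_nonpos_of_nonneg_of_nonpos he.le (mul_nonpos_of_nonneg_of_nonpos hRk h)).trans hmin
    rcases le_or_gt (n * η₁) S₁ with h1 | h1
    · exact neg (by linarith [bad (by positivity) h1])
    rcases le_or_gt (n * η₂) S₂ with h2 | h2
    · exact neg (by linarith [bad (by positivity) h2])
    by_cases hz : ∏ l, R (k l) = 0
    · simpa [hz] using hmin
    have hz' : ∀ l, R (k l) ≠ 0 := fun l => (Finset.prod_ne_zero_iff.1 hz) l (Finset.mem_univ _)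
    have eP : ∏ l, P (k l) = (∏ l, R (k l)) * Real.exp (-∑ l, g (k l)) := by
      rw [Finset.prod_congr rfl fun l _ => hg _ (hz' l), Finset.prod_mul_distrib,
        ← Real.exp_sum, Finset.sum_neg_distrib]
    have eQ : ∏ l, P (k l) = (∏ l, Q (k l)) * Real.exp (∑ l, ℓ (k l)) := by
      rw [Finset.prod_congr rfl fun l _ => hℓ _ (hz' l), Finset.prod_mul_distrib, ← Real.exp_sum]
    have b1 : Real.exp (-(n * α)) *
          ((∏ l, R (k l)) * (1 - S₁ ^ 2 / (n * η₁) ^ 2 - S₂ ^ 2 / (n * η₂) ^ 2)) ≤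
        ∏ l, P (k l) := by
      rw [eP]
      have hle : Real.exp (-(n * α)) ≤ Real.exp (-∑ l, g (k l)) := by
        apply Real.exp_le_exp.2
        have := mul_le_mul_of_nonneg_left hα hn'.le
        linarith
      calc _ ≤ Real.exp (-(n * α)) * ((∏ l, R (k l)) * 1) := by gcongr; linarith
        _ ≤ Real.exp (-∑ l, g (k l)) * ((∏ l, R (k l)) * 1) := by gcongr
        _ = _ := by ring
    refine le_min b1 (b1.trans ?_)
    rw [eQ, mul_comm]
    refine mul_le_mul_of_nonneg_right (Real.exp_le_exp.2 ?_) hQk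
    have := mul_le_mul_of_nonneg_left hτ hn'.le
    linarith
  refine le_trans ?_ (Finset.sum_le_sum fun k _ => key k)
  rw [← Finset.mul_sum, Finset.sum_sub_distrib, Finset.sum_sub_distrib, ← Finset.sum_div,
    ← Finset.sum_div, sum_prod_fin R hR, sum_prod_mul_sq R g hR m₁ hm₁,
    sum_prod_mul_sq R ℓ hR m₂ hm₂]
  refine mul_le_mul_of_nonneg_left ?_ (Real.exp_pos _).le
  have q : ∀ {x K η : ℝ}, 0 < η → x ≤ K → n * x / (n * η) ^ 2 ≤ K / (n * η ^ 2) :=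
    fun {x K η} hη h => by
      rw [show n * x / (n * η) ^ 2 = x / (n * η ^ 2) by field_simp]
      gcongr
  linarith [q hη₁ hK₁, q hη₂ hK₂]

lemma abs_log_one_add_sub_le {u : ℝ} (hu : |u| ≤ 1 / 2) :
    |Real.log (1 + u) - (u - u ^ 2 / 2)| ≤ 2 * |u| ^ 3 := by
  have h := Real.abs_log_sub_add_sum_range_le (x := -u) (by rw [abs_neg]; linarith) 2
  rw [abs_neg] at h
  simp only [Finset.sum_range_succ, Finset.sum_range_zero] at h
  have h2 : |u| ^ (2 + 1) / (1 - |u|) ≤ 2 * |u| ^ 3 := by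
    rw [div_le_iff₀ (by linarith), show 2 + 1 = 3 from rfl]
    have := mul_le_mul_of_nonneg_left hu (pow_nonneg (abs_nonneg u) 3)
    linarith
  refine le_trans (le_of_eq ?_) (h.trans h2)
  congr 1
  norm_num
  ring

/-- With `u = sZ`, averaging over `P` kills the linear term and leaves `s²V/2` as the relative
entropy cost of the tilt. -/
lemma one_add_mul_log_le {u : ℝ} (hu : |u| ≤ 1 / 2) :
    (1 + u) * Real.log (1 + u) ≤ u + u ^ 2 / 2 + 4 * |u| ^ 3 := by
  have h := (abs_le.1 (abs_log_one_add_sub_le hu)).2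
  have hu' := abs_le.1 hu
  have h3 : -u ^ 3 ≤ |u| ^ 3 := by rw [← abs_pow]; exact neg_le_abs _
  have hp := pow_nonneg (abs_nonneg u) 3
  have h4 : (1 + u) * Real.log (1 + u) ≤ (1 + u) * (u - u ^ 2 / 2 + 2 * |u| ^ 3) :=
    mul_le_mul_of_nonneg_left (by linarith) (by linarith)
  nlinarith

lemma abs_log_one_add_le {u : ℝ} (hu : |u| ≤ 1 / 2) : |Real.log (1 + u)| ≤ 2 * |u| := by
  have h := abs_le.1 (abs_log_one_add_sub_le hu)
  have hp := abs_nonneg u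
  have h2 : u ^ 2 ≤ 1 / 2 * |u| := by rw [← sq_abs]; nlinarith
  have h3 : 2 * |u| ^ 3 ≤ 1 / 2 * |u| := by
    have : |u| ^ 2 ≤ 1 / 4 := by nlinarith
    nlinarith
  have h4 := neg_abs_le u
  have h5 := le_abs_self u
  have h6 := sq_nonneg u
  rw [abs_le]
  constructor <;> linarith

/-- Moderate deviation lower bound for the overlap of product distributions. -/
lemma eventually_le_sum_min_prod (P Q : κ → ℝ) (hP : ∀ k, 0 ≤ P k) (hQ : ∀ k, 0 ≤ Q k)
    (hP1 : ∑ k, P k = 1) (hac : ∀ k, Q k = 0 → P k = 0) {D V : ℝ}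
    (hD : ∑ k, P k * llr P Q k = D) (hV : ∑ k, P k * (llr P Q k - D) ^ 2 = V)
    {a : ℕ → ℝ} (ha : ∀ n, 0 ≤ a n) (ha0 : Tendsto a atTop (𝓝 0))
    (hna : Tendsto (fun n : ℕ => (n : ℝ) * a n ^ 2) atTop atTop)
    {c δ : ℝ} (hc : 0 ≤ c) (hcV : c ^ 2 * V / 2 < 1) (hδ : 0 < δ) :
    ∀ᶠ n : ℕ in atTop, 4 * Real.exp (-((n : ℝ) * a n ^ 2)) ≤
      ∑ k : Fin n → κ, min (∏ l, P (k l))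
        (Real.exp (n * (D - c * V * a n + δ * a n)) * ∏ l, Q (k l)) := by
  obtain ⟨B, hB1, hB⟩ : ∃ B : ℝ, 1 ≤ B ∧ ∀ k, |D - llr P Q k| ≤ B := by
    refine ⟨1 + ∑ k, |D - llr P Q k|, by
      have := Finset.sum_nonneg fun k (_ : k ∈ Finset.univ) => abs_nonneg (D - llr P Q k)
      linarith, fun k => ?_⟩
    have := Finset.single_le_sum (f := fun k => |D - llr P Q k|) (fun k _ => abs_nonneg _)
      (Finset.mem_univ k)
    linarith
  have hB0 : 0 < B := by linarith
  set Z : κ → ℝ := fun k => D - llr P Q k with hZ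
  have hPZ : ∑ k, P k * Z k = 0 := by
    simp_rw [hZ, mul_sub, Finset.sum_sub_distrib, ← Finset.sum_mul, hP1, hD]; ring
  have hPZ2 : ∑ k, P k * Z k ^ 2 = V := by
    rw [← hV]; exact Finset.sum_congr rfl fun k _ => by simp only [hZ]; ring
  -- Since `c²V/2 = 1 - 2γ`, the cubic remainder and the Chebyshev margin `η₁` can take `γ/2` each,
  -- giving cost `(1 - γ) aₙ²`.
  set γ : ℝ := (1 - c ^ 2 * V / 2) / 2 with hγ
  have hγ0 : 0 < γ := by rw [hγ]; linarith
  have ev1 : ∀ᶠ n in atTop, c * a n * B < 1 / 2 := by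
    have : Tendsto (fun n => c * a n * B) atTop (𝓝 (c * 0 * B)) :=
      (ha0.const_mul c).mul_const B
    exact this.eventually_lt_const (by norm_num)
  have ev2 : ∀ᶠ n in atTop, 4 * B ^ 3 * c ^ 3 * a n < γ / 2 := by
    have : Tendsto (fun n => 4 * B ^ 3 * c ^ 3 * a n) atTop (𝓝 (4 * B ^ 3 * c ^ 3 * 0)) :=
      ha0.const_mul _
    exact this.eventually_lt_const (by simpa using by positivity)
  filter_upwards [ev1, ev2, eventually_gt_atTop 0,
    hna.eventually_ge_atTop (Real.log 8 / γ), hna.eventually_gt_atTop 0,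
    hna.eventually_ge_atTop (4 * (16 * c ^ 2 * B ^ 2 / γ ^ 2)),
    hna.eventually_ge_atTop (4 * (2 * B ^ 2 / δ ^ 2))] with n h1 h2 hn h3 h4 h5 h6
  have hn' : (0 : ℝ) < n := by exact_mod_cast hn
  have han : 0 < a n := by
    rcases (ha n).eq_or_lt with h | h
    · rw [← h] at h4; simp at h4
    · exact h
  set s := c * a n with hs
  have hs0 : 0 ≤ s := mul_nonneg hc han.le
  have hsZ : ∀ k, |s * Z k| ≤ s * B := fun k => by
    rw [abs_mul, abs_of_nonneg hs0]; exact mul_le_mul_of_nonneg_left (hB k) hs0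
  have hsZ2 : ∀ k, |s * Z k| ≤ 1 / 2 := fun k => (hsZ k).trans h1.le
  have hpos : ∀ k, 0 < 1 + s * Z k := fun k => by linarith [(abs_le.1 (hsZ2 k)).1]
  -- A linearised exponential tilt; it needs no normalising constant because `Z` has `P`-mean zero.
  set R : κ → ℝ := fun k => P k * (1 + s * Z k) with hRdef
  have hR0 : ∀ k, 0 ≤ R k := fun k => mul_nonneg (hP k) (hpos k).le
  have hR : ∑ k, R k = 1 := by
    have : ∀ k, R k = P k + s * (P k * Z k) := fun k => by simp only [hRdef]; ring
    rw [Finset.sum_congr rfl fun k _ => this k, Finset.sum_add_distrib, ← Finset.mul_sum, hPZ, hP1]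
    ring
  have hRP : ∀ k, R k ≠ 0 → 0 < P k := fun k hk =>
    lt_of_le_of_ne (hP k) fun h => hk (by simp only [hRdef]; rw [← h, zero_mul])
  have hRZ : ∑ k, R k * Z k = s * V := by
    have : ∀ k, R k * Z k = P k * Z k + s * (P k * Z k ^ 2) := fun k => by
      simp only [hRdef]; ring
    rw [Finset.sum_congr rfl fun k _ => this k, Finset.sum_add_distrib, ← Finset.mul_sum, hPZ,
      hPZ2]
    ring
  have hRbdd : ∀ (f : κ → ℝ) (K : ℝ), (∀ k, |f k| ≤ K) → ∑ k, R k * f k ^ 2 ≤ K ^ 2 := by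
    intro f K hf
    calc ∑ k, R k * f k ^ 2 ≤ ∑ k, R k * K ^ 2 := Finset.sum_le_sum fun k _ => by
          refine mul_le_mul_of_nonneg_left ?_ (hR0 k)
          rw [← sq_abs]
          exact pow_le_pow_left₀ (abs_nonneg _) (hf k) 2
      _ = K ^ 2 := by rw [← Finset.sum_mul, hR, one_mul]
  have hm2 : ∑ k, R k * llr P Q k = D - s * V := by
    have : ∀ k, R k * llr P Q k = R k * D - R k * Z k := fun k => by simp only [hZ]; ring
    rw [Finset.sum_congr rfl fun k _ => this k, Finset.sum_sub_distrib, ← Finset.sum_mul, hR, hRZ]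
    ring
  have hK2 : (∑ k, R k * llr P Q k ^ 2) - (D - s * V) ^ 2 ≤ B ^ 2 := by
    have : ∀ k, R k * llr P Q k ^ 2 = R k * D ^ 2 - 2 * D * (R k * Z k) + R k * Z k ^ 2 :=
      fun k => by simp only [hZ]; ring
    rw [Finset.sum_congr rfl fun k _ => this k, Finset.sum_add_distrib, Finset.sum_sub_distrib,
      ← Finset.sum_mul, ← Finset.mul_sum, hR, hRZ]
    nlinarith [hRbdd Z B hB, sq_nonneg (s * V)]
  have hm1 : ∑ k, R k * Real.log (1 + s * Z k) ≤ s ^ 2 * V / 2 + 4 * B ^ 3 * s ^ 3 := by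
    calc ∑ k, R k * Real.log (1 + s * Z k)
        ≤ ∑ k, (s * (P k * Z k) + s ^ 2 / 2 * (P k * Z k ^ 2) + P k * (4 * (s * B) ^ 3)) := by
          refine Finset.sum_le_sum fun k _ => ?_
          have h := mul_le_mul_of_nonneg_left (one_add_mul_log_le (hsZ2 k)) (hP k)
          have h' : P k * (4 * |s * Z k| ^ 3) ≤ P k * (4 * (s * B) ^ 3) :=
            mul_le_mul_of_nonneg_left (by gcongr; exact hsZ k) (hP k)
          simp only [hRdef]
          nlinarith
      _ = s ^ 2 * V / 2 + 4 * B ^ 3 * s ^ 3 := by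
          rw [Finset.sum_add_distrib, Finset.sum_add_distrib, ← Finset.mul_sum, ← Finset.mul_sum,
            ← Finset.sum_mul, hPZ, hPZ2, hP1]
          ring
  have hK1 : (∑ k, R k * Real.log (1 + s * Z k) ^ 2)
      - (∑ k, R k * Real.log (1 + s * Z k)) ^ 2 ≤ (2 * (s * B)) ^ 2 := by
    have := hRbdd (fun k => Real.log (1 + s * Z k)) (2 * (s * B)) fun k =>
      (abs_log_one_add_le (hsZ2 k)).trans (by linarith [hsZ k])
    linarith [sq_nonneg (∑ k, R k * Real.log (1 + s * Z k))]
  have main := le_sum_min_prod P Q R (fun k => Real.log (1 + s * Z k)) (llr P Q) hP hQ hR0 hR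
    (fun k hk => by
      rw [Real.exp_neg, Real.exp_log (hpos k)]
      simp only [hRdef]
      rw [mul_assoc, mul_inv_cancel₀ (hpos k).ne', mul_one])
    (fun k hk => by
      have hp := hRP k hk
      have hq : 0 < Q k := lt_of_le_of_ne (hQ k) fun h => hp.ne' (hac k h.symm)
      rw [llr, Real.exp_log (by positivity)]
      field_simp)
    (α := (1 - γ) * a n ^ 2) (τ := D - c * V * a n + δ * a n) (η₁ := γ / 2 * a n ^ 2)
    (η₂ := δ * a n) rfl hm2 hK1 hK2 (by positivity) (by positivity)
    (by
      have : 4 * B ^ 3 * c ^ 3 * a n * a n ^ 2 ≤ γ / 2 * a n ^ 2 := by gcongr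
      have e : s ^ 2 * V / 2 = (1 - 2 * γ) * a n ^ 2 := by rw [hs, hγ]; ring
      have e2 : 4 * B ^ 3 * s ^ 3 = 4 * B ^ 3 * c ^ 3 * a n * a n ^ 2 := by rw [hs]; ring
      rw [e, e2] at hm1
      linarith)
    (by rw [hs]; apply le_of_eq; ring) n hn
  refine le_trans ?_ main
  have f1 : (2 * (s * B)) ^ 2 / (n * (γ / 2 * a n ^ 2) ^ 2) ≤ 1 / 4 := by
    have e : (2 * (s * B)) ^ 2 / (n * (γ / 2 * a n ^ 2) ^ 2) =
        16 * c ^ 2 * B ^ 2 / γ ^ 2 / (n * a n ^ 2) := by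
      rw [hs]; field_simp; ring
    rw [e, div_le_iff₀ h4]
    linarith
  have f2 : B ^ 2 / (n * (δ * a n) ^ 2) ≤ 1 / 4 := by
    have e : B ^ 2 / (n * (δ * a n) ^ 2) = B ^ 2 / δ ^ 2 / (n * a n ^ 2) := by field_simp
    have : 2 * B ^ 2 / δ ^ 2 = 2 * (B ^ 2 / δ ^ 2) := by ring
    have : 0 ≤ B ^ 2 / δ ^ 2 := by positivity
    rw [e, div_le_iff₀ h4]
    linarith
  -- The spare factor `exp(γ n aₙ²)` eventually exceeds 8; Chebyshev retains half of it, whence the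
  -- 4.
  have f3 : 8 * Real.exp (-(n * a n ^ 2)) ≤ Real.exp (-(n * ((1 - γ) * a n ^ 2))) := by
    rw [show -(n * ((1 - γ) * a n ^ 2)) = γ * (n * a n ^ 2) + -(n * a n ^ 2) by ring, Real.exp_add]
    refine mul_le_mul_of_nonneg_right ?_ (Real.exp_pos _).le
    rw [div_le_iff₀ hγ0] at h3
    rw [← Real.log_le_iff_le_exp (by norm_num)]
    linarith
  have f4 : Real.exp (-(n * ((1 - γ) * a n ^ 2))) * (1 / 2) ≤
      Real.exp (-(n * ((1 - γ) * a n ^ 2))) *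
        (1 - (2 * (s * B)) ^ 2 / (n * (γ / 2 * a n ^ 2) ^ 2) - B ^ 2 / (n * (δ * a n) ^ 2)) :=
    mul_le_mul_of_nonneg_left (by linarith) (Real.exp_pos _).le
  linarith

end Classical

end QHT

namespace QHT

open Matrix

/-! ### Quantum converse for a single pair of operators. -/

section Converse

variable {m : Type*} [DecidableEq m]

lemma IsTest.one_sub {T : Matrix m m ℂ} (hT : IsTest T) : IsTest (1 - T) :=
  ⟨hT.2, by simpa using hT.1⟩

variable [Fintype m]

/-- `T - T² = T(1 - T)T + (1 - T)T(1 - T)`. -/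
lemma IsTest.posSemidef_sub_mul_self {T : Matrix m m ℂ} (hT : IsTest T) :
    (T - T * T).PosSemidef := by
  have h1 := hT.2.conjTranspose_mul_mul_same T
  have h2 := hT.1.conjTranspose_mul_mul_same (1 - T)
  rw [hT.1.isHermitian.eq] at h1
  rw [hT.2.isHermitian.eq] at h2
  convert h1.add h2 using 1
  noncomm_ring

/-- Error probabilities in a spectral basis bound the squared matrix elements of the test. -/
lemma IsTest.sum_le_trace {T X Y : Matrix m m ℂ} (hT : IsTest T) (hY : Y * Yᴴ = 1)
    {lam : m → ℝ} (hlam : ∀ i, 0 ≤ lam i) :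
    ∑ i, ∑ j, lam i * ‖(Xᴴ * T * Y) i j‖ ^ 2 ≤
      (T * (X * diagonal (fun i => (lam i : ℂ)) * Xᴴ)).trace.re := by
  have e1 : (T * (X * diagonal (fun i => (lam i : ℂ)) * Xᴴ)).trace =
      ∑ i, (Xᴴ * T * X) i i * lam i := by
    rw [← Matrix.mul_assoc, Matrix.trace_mul_comm, ← Matrix.mul_assoc, ← Matrix.mul_assoc]
    simp [Matrix.trace, Matrix.mul_diagonal]
  rw [e1, Complex.re_sum]
  refine Finset.sum_le_sum fun i _ => ?_
  -- `T ≥ T² = T Y Yᴴ T`, so each diagonal entry in the basis `X` dominates a row sum of squares.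
  have h := (hT.posSemidef_sub_mul_self.conjTranspose_mul_mul_same X).diag_nonneg (i := i)
  have e2 : Xᴴ * (T - T * T) * X = Xᴴ * T * X - (Xᴴ * T * Y) * (Xᴴ * T * Y)ᴴ := by
    rw [Matrix.conjTranspose_mul, Matrix.conjTranspose_mul, conjTranspose_conjTranspose,
      hT.1.isHermitian.eq,
      show Xᴴ * T * Y * (Yᴴ * (T * X)) = Xᴴ * T * (Y * Yᴴ) * (T * X) by
        simp only [Matrix.mul_assoc], hY]
    noncomm_ring
  rw [e2, Matrix.sub_apply, Matrix.mul_apply (M := Xᴴ * T * Y)] at h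
  have h' := (Complex.le_def.1 h).1
  rw [Complex.sub_re, Complex.re_sum] at h'
  have e3 : ∀ j, ((Xᴴ * T * Y) i j * (Xᴴ * T * Y)ᴴ j i).re = ‖(Xᴴ * T * Y) i j‖ ^ 2 := fun j => by
    rw [conjTranspose_apply, Complex.star_def, Complex.mul_conj, Complex.ofReal_re,
      Complex.normSq_eq_norm_sq]
  rw [Finset.sum_congr rfl fun j _ => e3 j] at h'
  rw [← Finset.mul_sum, Complex.re_mul_ofReal, mul_comm]
  refine mul_le_mul_of_nonneg_right ?_ (hlam i)
  simpa using h'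

/-- Split `⟨x|y⟩ = ⟨x|T|y⟩ + ⟨x|(1 - T)|y⟩`; the factor 1/2 comes from `|u + v|² ≤ 2(|u|² + |v|²)`.
-/
lemma sum_min_le_typeI_add_typeII {T X Y : Matrix m m ℂ} (hT : IsTest T) (hX : X * Xᴴ = 1)
    (hY : Y * Yᴴ = 1) {lam mu : m → ℝ} (hlam : ∀ i, 0 ≤ lam i) (hmu : ∀ i, 0 ≤ mu i)
    {θ : ℝ} (hθ : 0 ≤ θ) :
    (1 / 2) * ∑ i, ∑ j, min (lam i) (θ * mu j) * ‖(Xᴴ * Y) i j‖ ^ 2 ≤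
      typeI (X * diagonal (fun i => (lam i : ℂ)) * Xᴴ) T +
        θ * typeII (Y * diagonal (fun i => (mu i : ℂ)) * Yᴴ) T := by
  have h1 := hT.sum_le_trace (X := X) hY hlam
  have h2 := mul_le_mul_of_nonneg_left (hT.one_sub.sum_le_trace (X := Y) hX hmu) hθ
  rw [Finset.sum_comm, Finset.mul_sum] at h2
  refine le_trans ?_ (add_le_add h1 h2)
  rw [Finset.mul_sum, ← Finset.sum_add_distrib]
  refine Finset.sum_le_sum fun i _ => ?_
  rw [Finset.mul_sum, Finset.mul_sum, ← Finset.sum_add_distrib]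
  refine Finset.sum_le_sum fun j _ => ?_
  have e : ‖(Yᴴ * (1 - T) * X) j i‖ = ‖(Xᴴ * (1 - T) * Y) i j‖ := by
    have : Xᴴ * (1 - T) * Y = (Yᴴ * (1 - T) * X)ᴴ := by
      rw [Matrix.conjTranspose_mul, Matrix.conjTranspose_mul, conjTranspose_conjTranspose,
        hT.2.isHermitian.eq, Matrix.mul_assoc]
    rw [this, conjTranspose_apply, norm_star]
  have e2 : (Xᴴ * Y) i j = (Xᴴ * T * Y) i j + (Xᴴ * (1 - T) * Y) i j := by
    rw [← Matrix.add_apply, ← Matrix.add_mul, ← Matrix.mul_add, add_sub_cancel, Matrix.mul_one]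
  rw [e, e2]
  set u := ‖(Xᴴ * T * Y) i j‖
  set v := ‖(Xᴴ * (1 - T) * Y) i j‖
  have h3 : ‖(Xᴴ * T * Y) i j + (Xᴴ * (1 - T) * Y) i j‖ ^ 2 ≤ 2 * (u ^ 2 + v ^ 2) := by
    refine (pow_le_pow_left₀ (norm_nonneg _) (norm_add_le _ _) 2).trans ?_
    nlinarith [sq_nonneg (u - v)]
  have hw : 0 ≤ min (lam i) (θ * mu j) := le_min (hlam i) (mul_nonneg hθ (hmu j))
  have h4 := mul_le_mul_of_nonneg_left h3 hw
  have h5 := mul_le_mul_of_nonneg_right (min_le_left (lam i) (θ * mu j)) (sq_nonneg u)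
  have h6 := mul_le_mul_of_nonneg_right (min_le_right (lam i) (θ * mu j)) (sq_nonneg v)
  linarith

lemma hypRelEntropy_le {ρ σ : Matrix m m ℂ} {ε b : ℝ} (hb : 0 < b)
    (h : ∀ T, IsTest T → typeI ρ T ≤ ε → b ≤ typeII σ T) :
    hypRelEntropy ε ρ σ ≤ ((-Real.log b : ℝ) : EReal) := by
  rw [hypRelEntropy, EReal.coe_neg, EReal.neg_le_neg_iff, ← ENNReal.log_ofReal_of_pos hb]
  exact ENNReal.log_le_log
    (le_iInf fun T => le_iInf fun hT => le_iInf fun hI => ENNReal.ofReal_le_ofReal (h T hT hI))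

/-- The zero test is admissible, so `beta` is finite. Needed because `EReal.toReal` is not monotone
at `⊥`. -/
lemma hypRelEntropy_ne_bot {ρ σ : Matrix m m ℂ} {ε : ℝ} (hε : 0 ≤ ε) :
    hypRelEntropy ε ρ σ ≠ ⊥ := by
  have h : beta ε ρ σ ≤ ENNReal.ofReal (typeII σ 0) :=
    iInf_le_of_le 0 <| iInf_le_of_le ⟨PosSemidef.zero, by simpa using PosSemidef.one⟩ <|
      iInf_le_of_le (by simpa [typeI] using hε) le_rfl
  rw [hypRelEntropy, Ne, EReal.neg_eq_bot_iff, ENNReal.log_eq_top_iff]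
  exact (h.trans_lt ENNReal.ofReal_lt_top).ne

end Converse

/-! ### Tensor powers are multiplicative. -/

section TensorPow

variable {ι : Type*}

lemma tensorPow_mul [Fintype ι] (A B : Matrix ι ι ℂ) (n : ℕ) :
    tensorPow (A * B) n = tensorPow A n * tensorPow B n := by
  ext i j
  simp only [tensorPow, Matrix.of_apply, Matrix.mul_apply, ← Finset.prod_mul_distrib]
  rw [Finset.prod_univ_sum, Fintype.piFinset_univ]

lemma tensorPow_conjTranspose (A : Matrix ι ι ℂ) (n : ℕ) :
    tensorPow Aᴴ n = (tensorPow A n)ᴴ := by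
  ext i j
  simp [tensorPow]

lemma tensorPow_diagonal [DecidableEq ι] (d : ι → ℂ) (n : ℕ) :
    tensorPow (diagonal d) n = diagonal fun i : Fin n → ι => ∏ l, d (i l) := by
  ext i j
  simp only [tensorPow, Matrix.of_apply, diagonal_apply]
  split_ifs with h
  · subst h; simp
  · obtain ⟨l, hl⟩ := Function.ne_iff.1 h
    exact Finset.prod_eq_zero (Finset.mem_univ l) (if_neg hl)

lemma tensorPow_one [DecidableEq ι] (n : ℕ) : tensorPow (1 : Matrix ι ι ℂ) n = 1 := by
  rw [← diagonal_one, tensorPow_diagonal]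
  simp

end TensorPow

/-! ### Spectral bases and the Nussbaum–Szkoła distributions. -/

section Spectral

variable {ι : Type*} [Fintype ι]

/-- The matrix whose columns are the vectors of an orthonormal basis. -/
noncomputable def basisMatrix (x : OrthonormalBasis ι ℂ (EuclideanSpace ℂ ι)) : Matrix ι ι ℂ :=
  Matrix.of fun k i => x i k

lemma basisMatrix_conjTranspose_mul (x y : OrthonormalBasis ι ℂ (EuclideanSpace ℂ ι)) (i j : ι) :
    ((basisMatrix x)ᴴ * basisMatrix y) i j = inner ℂ (x i) (y j) := by
  simp [Matrix.mul_apply, basisMatrix, PiLp.inner_apply, mul_comm]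

lemma sum_nsP {lam : ι → ℝ} (hlam : ∑ i, lam i = 1)
    (x y : OrthonormalBasis ι ℂ (EuclideanSpace ℂ ι)) : ∑ k, nsP lam x y k = 1 := by
  rw [Fintype.sum_prod_type, ← hlam]
  refine Finset.sum_congr rfl fun i _ => ?_
  simp only [nsP]
  rw [← Finset.mul_sum, y.sum_sq_norm_inner_left, x.norm_eq_one]
  simp

variable [DecidableEq ι]

lemma basisMatrix_mul_conjTranspose (x : OrthonormalBasis ι ℂ (EuclideanSpace ℂ ι)) :
    basisMatrix x * (basisMatrix x)ᴴ = 1 := by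
  rw [mul_eq_one_comm]
  ext i j
  rw [basisMatrix_conjTranspose_mul, orthonormal_iff_ite.1 x.orthonormal, Matrix.one_apply]

lemma IsSpectralDecomp.eq_mul {ρ : Matrix ι ι ℂ} {lam : ι → ℝ}
    {x : OrthonormalBasis ι ℂ (EuclideanSpace ℂ ι)} (h : IsSpectralDecomp ρ lam x) :
    ρ = basisMatrix x * diagonal (fun i => (lam i : ℂ)) * (basisMatrix x)ᴴ := by
  rw [h]
  ext k l
  rw [Matrix.sum_apply, Matrix.mul_apply]
  refine Finset.sum_congr rfl fun i _ => ?_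
  simp [basisMatrix, vecMulVec_apply]
  ring

lemma IsSpectralDecomp.nonneg {ρ : Matrix ι ι ℂ} {lam : ι → ℝ}
    {x : OrthonormalBasis ι ℂ (EuclideanSpace ℂ ι)} (h : IsSpectralDecomp ρ lam x)
    (hρ : ρ.PosSemidef) (i : ι) : 0 ≤ lam i := by
  have h1 := hρ.conjTranspose_mul_mul_same (basisMatrix x)
  have hx := mul_eq_one_comm.1 (basisMatrix_mul_conjTranspose x)
  rw [h.eq_mul, show ∀ X D : Matrix ι ι ℂ, Xᴴ * (X * D * Xᴴ) * X = (Xᴴ * X) * D * (Xᴴ * X) by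
    intros; simp only [Matrix.mul_assoc], hx, Matrix.one_mul, Matrix.mul_one,
    posSemidef_diagonal_iff] at h1
  exact_mod_cast h1 i

lemma IsSpectralDecomp.sum_eq_one {ρ : Matrix ι ι ℂ} {lam : ι → ℝ}
    {x : OrthonormalBasis ι ℂ (EuclideanSpace ℂ ι)} (h : IsSpectralDecomp ρ lam x)
    (hρ : ρ.trace = 1) : ∑ i, lam i = 1 := by
  have hx := mul_eq_one_comm.1 (basisMatrix_mul_conjTranspose x)
  rw [h.eq_mul, Matrix.trace_mul_comm, ← Matrix.mul_assoc, hx, Matrix.one_mul,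
    trace_diagonal] at hρ
  exact_mod_cast hρ

/-- The tensor power of a spectral decomposition. -/
lemma IsSpectralDecomp.tensorPow_eq {ρ : Matrix ι ι ℂ} {lam : ι → ℝ}
    {x : OrthonormalBasis ι ℂ (EuclideanSpace ℂ ι)} (h : IsSpectralDecomp ρ lam x) (n : ℕ) :
    tensorPow ρ n = tensorPow (basisMatrix x) n *
      diagonal (fun i : Fin n → ι => ((∏ l, lam (i l) : ℝ) : ℂ)) *
        (tensorPow (basisMatrix x) n)ᴴ := by
  rw [h.eq_mul, tensorPow_mul, tensorPow_mul, tensorPow_conjTranspose, tensorPow_diagonal]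
  simp

/-- The Nussbaum–Szkoła converse bound for independent copies. -/
lemma sum_min_prod_le {ρ σ : Matrix ι ι ℂ} (hρ : ρ.PosSemidef) (hσ : σ.PosSemidef)
    {lam mu : ι → ℝ} {x y : OrthonormalBasis ι ℂ (EuclideanSpace ℂ ι)}
    (hx : IsSpectralDecomp ρ lam x) (hy : IsSpectralDecomp σ mu y) {n : ℕ}
    {T : Matrix (Fin n → ι) (Fin n → ι) ℂ} (hT : IsTest T) {θ : ℝ} (hθ : 0 ≤ θ) :
    (1 / 2) * ∑ k : Fin n → ι × ι,
        min (∏ l, nsP lam x y (k l)) (θ * ∏ l, nsQ mu x y (k l)) ≤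
      typeI (tensorPow ρ n) T + θ * typeII (tensorPow σ n) T := by
  have unit : ∀ z : OrthonormalBasis ι ℂ (EuclideanSpace ℂ ι),
      tensorPow (basisMatrix z) n * (tensorPow (basisMatrix z) n)ᴴ = 1 := fun z => by
    rw [← tensorPow_conjTranspose, ← tensorPow_mul, basisMatrix_mul_conjTranspose, tensorPow_one]
  have h := sum_min_le_typeI_add_typeII hT (unit x) (unit y)
    (lam := fun i => ∏ l, lam (i l)) (mu := fun i => ∏ l, mu (i l))
    (fun i => Finset.prod_nonneg fun l _ => hx.nonneg hρ _)
    (fun i => Finset.prod_nonneg fun l _ => hy.nonneg hσ _) hθ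
  rw [← hx.tensorPow_eq, ← hy.tensorPow_eq] at h
  refine le_of_eq_of_le ?_ h
  rw [← (Equiv.arrowProdEquivProdArrow (Fin n) (fun _ => ι) (fun _ => ι)).symm.sum_comp,
    Fintype.sum_prod_type]
  congr 1
  refine Finset.sum_congr rfl fun i _ => Finset.sum_congr rfl fun j _ => ?_
  rw [← tensorPow_conjTranspose, ← tensorPow_mul, min_mul_of_nonneg _ _ (sq_nonneg _)]
  have e : ‖tensorPow ((basisMatrix x)ᴴ * basisMatrix y) n i j‖ ^ 2 =
      ∏ l, ‖inner ℂ (x (i l)) (y (j l))‖ ^ 2 := by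
    simp only [tensorPow, Matrix.of_apply, basisMatrix_conjTranspose_mul, norm_prod,
      Finset.prod_pow]
  rw [e]
  simp only [nsP, nsQ, Finset.prod_mul_distrib, Equiv.arrowProdEquivProdArrow_symm_apply,
    mul_assoc]

end Spectral

/-! ### Combining the converse with the overlap bound. -/

section SecondOrder

variable {ι : Type*} [Fintype ι] [DecidableEq ι]

lemma eventually_hypRelEntropy_le {ρ σ : Matrix ι ι ℂ} (hρ : IsDensity ρ) (hσ : IsDensity σ)
    {lam mu : ι → ℝ} {x y : OrthonormalBasis ι ℂ (EuclideanSpace ℂ ι)}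
    (hx : IsSpectralDecomp ρ lam x) (hy : IsSpectralDecomp σ mu y)
    (hac : ∀ k, nsQ mu x y k = 0 → nsP lam x y k = 0) {D V : ℝ}
    (hD : ∑ k, nsP lam x y k * llr (nsP lam x y) (nsQ mu x y) k = D)
    (hV : ∑ k, nsP lam x y k * (llr (nsP lam x y) (nsQ mu x y) k - D) ^ 2 = V)
    {a : ℕ → ℝ} (ha : ∀ n, 0 ≤ a n) (ha0 : Tendsto a atTop (𝓝 0))
    (hna : Tendsto (fun n : ℕ => (n : ℝ) * a n ^ 2) atTop atTop) {δ : ℝ} (hδ : 0 < δ) :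
    ∀ᶠ n : ℕ in atTop,
      hypRelEntropy (Real.exp (-((n : ℝ) * a n ^ 2))) (tensorPow ρ n) (tensorPow σ n) ≤
        ((n * D - √(2 * V) * (n * a n) + δ * (n * a n) : ℝ) : EReal) := by
  have hP : ∀ k, 0 ≤ nsP lam x y k := fun k => mul_nonneg (hx.nonneg hρ.1 _) (sq_nonneg _)
  have hQ : ∀ k, 0 ≤ nsQ mu x y k := fun k => mul_nonneg (hy.nonneg hσ.1 _) (sq_nonneg _)
  have hV0 : 0 ≤ V := hV ▸ Finset.sum_nonneg fun k _ => mul_nonneg (hP k) (sq_nonneg _)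
  -- `c` sits just below `√(2/V)`; for `V = 0` take `c = 0`.
  obtain ⟨c, hc, hcV, hcδ⟩ : ∃ c : ℝ, 0 ≤ c ∧ c ^ 2 * V / 2 < 1 ∧ √(2 * V) - δ / 3 ≤ c * V := by
    rcases hV0.eq_or_lt with h | h
    · exact ⟨0, le_rfl, by simp, by rw [← h]; simp; positivity⟩
    set w := √(2 * V) with hw
    have hw0 : 0 < w := Real.sqrt_pos.2 (by positivity)
    have hw2 : w ^ 2 = 2 * V := Real.sq_sqrt (by positivity)
    refine ⟨max 0 (w - δ / 3) / V, by positivity, ?_, ?_⟩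
    · have h1 : max 0 (w - δ / 3) < w := max_lt hw0 (by linarith)
      have h2 : max 0 (w - δ / 3) ^ 2 < w ^ 2 :=
        pow_lt_pow_left₀ h1 (le_max_left _ _) (by norm_num)
      rw [show (max 0 (w - δ / 3) / V) ^ 2 * V / 2 = max 0 (w - δ / 3) ^ 2 / (2 * V) by
        field_simp, div_lt_one (by positivity)]
      linarith
    · rw [div_mul_cancel₀ _ h.ne']
      exact le_max_right _ _
  filter_upwards [eventually_le_sum_min_prod _ _ hP hQ (sum_nsP (hx.sum_eq_one hρ.2) x y) hac hD hV
    ha ha0 hna hc hcV (show 0 < δ / 3 by positivity),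
    ha0.eventually_lt_const (show 0 < δ / 3 by positivity)] with n hn han
  set τ := n * (D - c * V * a n + δ / 3 * a n) with hτ
  have hτ0 := Real.exp_pos τ
  -- Half the overlap is at least `2ε` and the type-I error at most `ε`, leaving `ε ≤ exp τ ·
  -- typeII`.
  refine (hypRelEntropy_le (b := Real.exp (-(n * a n ^ 2)) / Real.exp τ) (by positivity)
    fun T hT hI => ?_).trans ?_
  · have h := sum_min_prod_le hρ.1 hσ.1 hx hy hT hτ0.le
    rw [div_le_iff₀ hτ0]
    linarith
  · rw [EReal.coe_le_coe_iff, ← Real.exp_sub, Real.log_exp, hτ]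
    -- Three errors of `δ/3`: the choice of `c`, the margin in `τ`, and `n aₙ² ≤ (δ/3) n aₙ`.
    have hn0 : 0 ≤ n * a n := mul_nonneg (Nat.cast_nonneg n) (ha n)
    have h1 := mul_le_mul_of_nonneg_left hcδ hn0
    have h2 := mul_le_mul_of_nonneg_left han.le hn0
    linarith

end SecondOrder

end QHT

theorem corollary2 {ι : Type*} [Fintype ι] [DecidableEq ι]
    (ρ σ : Matrix ι ι ℂ) (hρ : QHT.IsDensity ρ) (hσ : QHT.IsDensity σ)
    (lam mu : ι → ℝ) (x y : OrthonormalBasis ι ℂ (EuclideanSpace ℂ ι))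
    (hx : QHT.IsSpectralDecomp ρ lam x) (hy : QHT.IsSpectralDecomp σ mu y)
    (P Q : ι × ι → ℝ) (hP : P = QHT.nsP lam x y) (hQ : Q = QHT.nsQ mu x y)
    (a : ℕ → ℝ) (ha : ∀ n, 0 ≤ a n) (ha0 : Tendsto a atTop (𝓝 0))
    (hna : Tendsto (fun n : ℕ => (n : ℝ) * a n ^ 2) atTop atTop)
    (ε : ℕ → ℝ) (hε : ∀ n : ℕ, ε n = Real.exp (-((n : ℝ) * a n ^ 2))) :
    ∃ r : ℕ → ℝ, r =o[atTop] (fun n : ℕ => (n : ℝ) * a n) ∧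
      ∀ᶠ n : ℕ in atTop,
        QHT.hypRelEntropy (ε n) (QHT.tensorPow ρ n) (QHT.tensorPow σ n) ≤
          ((n : ℝ) : EReal) * QHT.relEntropy P Q
            - ((√(2 * QHT.relVariance P Q) * ((n : ℝ) * a n) : ℝ) : EReal)
            + ((r n : ℝ) : EReal) := by
  obtain rfl := funext hε
  subst hP hQ
  by_cases hac : ∀ k, QHT.nsQ mu x y k = 0 → QHT.nsP lam x y k = 0
  · set D := ∑ k, QHT.nsP lam x y k * QHT.llr (QHT.nsP lam x y) (QHT.nsQ mu x y) k with hD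
    have hrel : QHT.relEntropy (QHT.nsP lam x y) (QHT.nsQ mu x y) = (D : EReal) := if_pos hac
    set V := QHT.relVariance (QHT.nsP lam x y) (QHT.nsQ mu x y) with hV
    rw [QHT.relVariance, hrel, EReal.toReal_coe] at hV
    set h : ℕ → EReal := fun n => QHT.hypRelEntropy (Real.exp (-((n : ℝ) * a n ^ 2)))
      (QHT.tensorPow ρ n) (QHT.tensorPow σ n) with hh
    have key : ∀ δ : ℝ, 0 < δ → ∀ᶠ n : ℕ in atTop,
        h n ≤ ((n * D - √(2 * V) * (n * a n) + δ * (n * a n) : ℝ) : EReal) := fun δ hδ =>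
      QHT.eventually_hypRelEntropy_le hρ hσ hx hy hac hD.symm hV.symm ha ha0 hna hδ
    -- The positive part of the actual excess serves every `δ` at once.
    refine ⟨fun n => max 0 ((h n).toReal - (n * D - √(2 * V) * (n * a n))), ?_, ?_⟩
    · rw [isLittleO_iff]
      intro δ hδ
      filter_upwards [key δ hδ] with n hn
      have hn0 : 0 ≤ n * a n := mul_nonneg (Nat.cast_nonneg n) (ha n)
      rw [Real.norm_of_nonneg (le_max_left _ _), Real.norm_of_nonneg hn0]
      refine max_le (by positivity) ?_
      have h1 := EReal.toReal_le_toReal hn (QHT.hypRelEntropy_ne_bot (Real.exp_pos _).le)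
        (EReal.coe_ne_top _)
      rw [EReal.toReal_coe] at h1
      linarith
    · filter_upwards [key 1 one_pos] with n hn
      rw [hrel, ← EReal.coe_mul, ← EReal.coe_sub, ← EReal.coe_add]
      refine (EReal.le_coe_toReal (ne_top_of_le_ne_top (EReal.coe_ne_top _) hn)).trans ?_
      rw [EReal.coe_le_coe_iff]
      linarith [le_max_right 0 ((h n).toReal - (n * D - √(2 * V) * (n * a n)))]
  · refine ⟨0, isLittleO_zero _ _, ?_⟩
    -- At `n = 0` the product `0 * ⊤` is `0` in `EReal`.
    filter_upwards [eventually_gt_atTop 0] with n hn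
    rw [QHT.relEntropy, if_neg hac, EReal.coe_mul_top_of_pos (by exact_mod_cast hn),
      EReal.top_sub_coe, EReal.top_add_coe]
    exact le_top
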